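/- Let $S$ be a finite monoid with unit $e$ and let $A$ be a finite nonempty set. An \emph{$S$-operation} on $A$ is an operation $f\colon A^n\to A$ with $n\ge 1$ together with a signum $\operatorname{sgn}(f)=(s_1,\dots,s_n)\in S^n$; $n$ is its arity. It is \emph{trivial} if for some $i$ we have $s_i=e$ and $f(x_1,\dots,x_n)=x_i$ for all $x_1,\dots,x_n\in A$, and \emph{nontrivial} otherwise. An \emph{$S$-preclone} on $A$ is a set of $S$-operations that contains the identity operation with signum $(e)$ and is closed under the following operations, where $\operatorname{sgn}(f)=(s_1,\dots,s_n)$, $\operatorname{sgn}(g)=(s'_1,\dots,s'_m)$ and $s\in S$: - $\zeta f(x_1,\dots,x_n)=f(x_2,\dots,x_n,x_1)$ with signum $(s_n,s_1,\dots,s_{n-1})$, and $\tau f(x_1,x_2,x_3,\dots,x_n)=f(x_2,x_1,x_3,\dots,x_n)$ with signum $(s_2,s_1,s_3,\dots,s_n)$ (for $n=1$, $\zeta f=\tau f=f$); - $\nabla^s f(x_1,\dots,x_{n+1})=f(x_2,\dots,x_{n+1})$ with signum $(s,s_1,\dots,s_n)$; - if $n\ge2$ and $s_1=s_2$, $\Delta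 f(x_1,\dots,x_{n-1})=f(x_1,x_1,x_2,\dots,x_{n-1})$ with signum $(s_2,s_3,\dots,s_n)$ (otherwise $\Delta f=f$); - $(f\circ g)(x_1,\dots,x_{m+n-1})=f(g(x_1,\dots,x_m),x_{m+1},\dots,x_{m+n-1})$ with signum $(s'_1s_1,\dots,s'_ms_1,s_2,\dots,s_n)$. The $S$-preclone generated by a set of $S$-operations is the least $S$-preclone containing it. Ordered by inclusion, the $S$-preclones on $A$ form a lattice with least element the set of all trivial $S$-operations and largest element the set of all $S$-operations; its atoms are called \emph{minimal} and its coatoms \emph{maximal} $S$-preclones. An $m$-ary \emph{$S$-relation} is a family $\rho=(\rho_s)_{s\in S}$ of subsets of $A^m$, and $\operatorname{SPol}\rho$ is the set of all $S$-operations $f$ such that $f(\rho_{s_1s},\dots,\rho_{s_ns})\subseteq\rho_s$ for all $s\in S$, where $(s_1,\dots,s_n)=\operatorname{sgn}(f)$ and $f$ acts componentwise on tuples. Then there are only finitely many maximal and only finitely many minimal $S$-preclones on $A$. Moreover, every maximal $S$-preclone equals $\operatorname{SPol}\rho$ for a single $S$-relation $\rho$ of arity $|A|^2$ or $|A|$,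 and every minimal $S$-preclone is generated by a single nontrivial $S$-operation of arity at most $|A|^2\cdot|S|$. -/

import Mathlib

/-- An `S`-operation on `A`: a finitary operation `A ^ n → A` with `n ≥ 1`, each of whose
arguments carries a label in `S`.  The arity `n` is stored as `pred + 1`; `sgn` is the signum
`(s₁, …, sₙ)` and `fn` is the underlying function. -/
@[ext]
structure SOp (S A : Type*) where
  pred : ℕ
  sgn : Fin (pred + 1) → S
  fn : (Fin (pred + 1) → A) → A

namespace SOp

variable {S A : Type*}

/-- The arity of an `S`-operation. -/
def arity (f : SOp S A) : ℕ := f.pred + 1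

/-- The identity operation, with signum `(e)`. -/
def ident [Monoid S] : SOp S A := ⟨0, fun _ => 1, fun x => x 0⟩

/-- Cyclic shift `ζ`: `(ζ f)(x₁, …, xₙ) = f(x₂, …, xₙ, x₁)` with signum `(sₙ, s₁, …, sₙ₋₁)`.
Addition and subtraction in `Fin n` are cyclic; for `n = 1` this is `f` itself. -/
def zeta (f : SOp S A) : SOp S A :=
  ⟨f.pred, fun i => f.sgn (i - 1), fun x => f.fn fun i => x (i + 1)⟩

/-- Permuting the first two arguments, `τ`: `(τ f)(x₁, x₂, x₃, …) = f(x₂, x₁, x₃, …)` with signum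
`(s₂, s₁, s₃, …)`.  For `n = 1` one has `0 = 1` in `Fin n`, and this is `f` itself. -/
def tau (f : SOp S A) : SOp S A :=
  ⟨f.pred, fun i => f.sgn (Equiv.swap 0 1 i), fun x => f.fn fun i => x (Equiv.swap 0 1 i)⟩

/-- Adding a fictitious argument with signum `s` at the first place, `∇ˢ`. -/
def nabla (s : S) (f : SOp S A) : SOp S A :=
  ⟨f.pred + 1, Fin.cons s f.sgn, fun x => f.fn (Fin.tail x)⟩

open Classical in
/-- Identification of the first two arguments, `Δ`, if there are at least two arguments and the
first two have the same signum: `(Δ f)(x₁, x₂, …) = f(x₁, x₁, x₂, …)`.  Otherwise `Δ f = f`. -/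
noncomputable def delta : SOp S A → SOp S A
  | ⟨0, σ, f⟩ => ⟨0, σ, f⟩
  | ⟨k + 1, σ, f⟩ =>
      if σ 0 = σ 1 then ⟨k, Fin.tail σ, fun x => f (Fin.cons (x 0) x)⟩ else ⟨k + 1, σ, f⟩

/-- Composition `f ∘ g` at the first place:
`(f ∘ g)(x₁, …, xₘ₊ₙ₋₁) = f(g(x₁, …, xₘ), xₘ₊₁, …, xₘ₊ₙ₋₁)`,
with signum `(s'₁ s₁, …, s'ₘ s₁, s₂, …, sₙ)`, where `(s'₁, …, s'ₘ)` is the signum of `g` and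
`(s₁, …, sₙ)` is the signum of `f`. -/
def comp [Monoid S] (f g : SOp S A) : SOp S A where
  pred := g.pred + f.pred
  sgn := fun i =>
    Fin.append (fun j => g.sgn j * f.sgn 0) (Fin.tail f.sgn) (Fin.cast (by omega) i)
  fn := fun x => f.fn (Fin.cons
    (g.fn fun j => x (Fin.cast (by omega) (Fin.castAdd f.pred j)))
    (fun j => x (Fin.cast (by omega) (Fin.natAdd (g.pred + 1) j))))

/-- Trivial `S`-operations: projections whose essential argument has signum `e`. -/
def IsTrivial [Monoid S] (f : SOp S A) : Prop :=
  ∃ i, f.sgn i = 1 ∧ ∀ x, f.fn x = x i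

end SOp

/-- An `S`-preclone on `A`: a set of `S`-operations that contains the identity operation and is
closed under `ζ`, `τ`, `∇ˢ` (`s ∈ S`), `Δ` and `∘`. -/
structure IsSPreclone {S A : Type*} [Monoid S] (F : Set (SOp S A)) : Prop where
  ident_mem : SOp.ident ∈ F
  zeta_mem : ∀ f ∈ F, f.zeta ∈ F
  tau_mem : ∀ f ∈ F, f.tau ∈ F
  nabla_mem : ∀ (s : S), ∀ f ∈ F, f.nabla s ∈ F
  delta_mem : ∀ f ∈ F, f.delta ∈ F
  comp_mem : ∀ f ∈ F, ∀ g ∈ F, f.comp g ∈ F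

/-- The `S`-preclone generated by a set of `S`-operations: the least one that contains it. -/
def SSg {S A : Type*} [Monoid S] (F : Set (SOp S A)) : Set (SOp S A) :=
  ⋂₀ {G | IsSPreclone G ∧ F ⊆ G}

/-- The set of all trivial `S`-operations, the least `S`-preclone on `A`. -/
def trivialSOps (S A : Type*) [Monoid S] : Set (SOp S A) :=
  {f | f.IsTrivial}

/-- An `m`-ary `S`-relation on `A`: a family, indexed by `S`, of `m`-ary relations on `A`. -/
abbrev SRel (S A : Type*) (m : ℕ) := S → Set (Fin m → A)

/-- `f` with signum `(s₁, …, sₙ)` `S`-preserves `ρ` if `f(ρ_{s₁ s}, …, ρ_{sₙ s}) ⊆ ρ_s` for all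
`s ∈ S`, where `f` acts componentwise on `m`-tuples. -/
def SOp.Preserves {S A : Type*} [Monoid S] {m : ℕ} (f : SOp S A) (ρ : SRel S A m) : Prop :=
  ∀ (s : S) (r : Fin (f.pred + 1) → Fin m → A),
    (∀ i, r i ∈ ρ (f.sgn i * s)) → (fun j => f.fn fun i => r i j) ∈ ρ s

/-- The set of `S`-polymorphisms of an `S`-relation. -/
def SPol {S A : Type*} [Monoid S] {m : ℕ} (ρ : SRel S A m) : Set (SOp S A) :=
  {f | f.Preserves ρ}

/-- A maximal `S`-preclone: a coatom of the lattice of `S`-preclones on `A`, whose largest element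
is the set of all `S`-operations. -/
def IsMaximalSPreclone {S A : Type*} [Monoid S] (F : Set (SOp S A)) : Prop :=
  Maximal (fun G => IsSPreclone G ∧ G ≠ Set.univ) F

/-- A minimal `S`-preclone: an atom of the lattice of `S`-preclones on `A`, whose least element is
the set of trivial `S`-operations. -/
def IsMinimalSPreclone {S A : Type*} [Monoid S] (F : Set (SOp S A)) : Prop :=
  Minimal (fun G => IsSPreclone G ∧ G ≠ trivialSOps S A) F

/-! Maximal preclones: let `F` be maximal and let `f ∉ F` have arity `n`. Tuples of length `|A|^n`
are functions `A^n → A`. Take `ρ_s` to be the functions obtained from members of `F` by substituting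
variables labelled by `sgn f` (`labelledSpan`). Then `F` preserves `ρ`, but `f` does not: applied to
the variables it returns itself, and `f ∈ ρ_1` would mean `f ∈ F`. By maximality `F = SPol ρ`. The
unary identities with arbitrary signum and the binary operations with signum `(e, e)` generate
everything, so `f` can be taken of arity 1 or 2. Over finite `S` and `A` there are finitely many
such `ρ`.

Minimal preclones: any nontrivial member generates, so a small one is needed. By a
principal-ultrafilter argument (`exists_eq_var_of_pairwise`), nontriviality of `f` is witnessed by
two points `x`, `y`. Identifying variables `i` with equal `(s_i, x_i, y_i)` keeps the witness and
leaves at most `|A|^2 * |S|` variables. -/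

/-- Membership in `F` of an operation whose arguments are indexed by a finite type `I`. -/
def OpMem {S A : Type*} (F : Set (SOp S A)) {I : Type} (σ : I → S) (φ : (I → A) → A) : Prop :=
  ∃ (n : ℕ) (e : Fin (n + 1) ≃ I),
    (⟨n, fun i => σ (e i), fun x => φ fun i => x (e.symm i)⟩ : SOp S A) ∈ F

/-- The functions `(D → A) → A` obtained from operations in `F` by substituting variables from `D`
in such a way that the labels, multiplied by `s`, become those given by `l`. -/
def labelledSpan {S A : Type*} [Mul S] (F : Set (SOp S A)) {D : Type} (l : D → S) (s : S) :
    Set ((D → A) → A) :=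
  {g | ∃ (J : Type) (θ : J → S) (ψ : (J → A) → A) (π : J → D), OpMem F θ ψ ∧
    (∀ j, θ j * s = l (π j)) ∧ ∀ y, g y = ψ fun j => y (π j)}

/-! ### Substitution calculus with variables indexed by arbitrary finite types -/

section Preclone

variable {S A : Type*}

theorem SOp.mk_congr {n : ℕ} {σ τ : Fin (n + 1) → S} {φ ψ : (Fin (n + 1) → A) → A}
    (h : ∀ i, σ i = τ i) (h' : ∀ x, φ x = ψ x) : (⟨n, σ, φ⟩ : SOp S A) = ⟨n, τ, ψ⟩ := by
  obtain rfl := funext h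
  obtain rfl := funext h'
  rfl

theorem OpMem.finite {F : Set (SOp S A)} {I : Type} {σ : I → S} {φ : (I → A) → A}
    (h : OpMem F σ φ) : Finite I := by
  obtain ⟨n, e, -⟩ := h
  exact Finite.of_equiv _ e

theorem OpMem.of_mem {F : Set (SOp S A)} {f : SOp S A} (h : f ∈ F) : OpMem F f.sgn f.fn :=
  ⟨f.pred, Equiv.refl _, h⟩

theorem OpMem.equiv {F : Set (SOp S A)} {I J : Type} {σ : I → S} {φ : (I → A) → A}
    (h : OpMem F σ φ) (p : I ≃ J) :
    OpMem F (fun j => σ (p.symm j)) (fun z => φ fun i => z (p i)) := by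
  obtain ⟨n, e, h⟩ := h
  exact ⟨n, e.trans p, by simpa using h⟩

theorem OpMem.congr {F : Set (SOp S A)} {I : Type} {σ τ : I → S} {φ ψ : (I → A) → A}
    (h : OpMem F σ φ) (hσ : ∀ i, τ i = σ i) (hφ : ∀ z, ψ z = φ z) : OpMem F τ ψ := by
  obtain rfl := funext hσ
  obtain rfl := funext hφ
  exact h

/-- Extending an enumeration of `I` to one of `Option I` that starts with `none`. -/
def consEquiv {n : ℕ} {I : Type} (e : Fin n ≃ I) : Fin (n + 1) ≃ Option I where
  toFun := Fin.cases none fun i => some (e i)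
  invFun := fun o => o.elim 0 fun i => (e.symm i).succ
  left_inv := fun i => by refine Fin.cases rfl (fun i => ?_) i; simp
  right_inv := by rintro (_ | i) <;> simp

@[simp] theorem consEquiv_zero {n : ℕ} {I : Type} (e : Fin n ≃ I) : consEquiv e 0 = none := rfl

@[simp] theorem consEquiv_succ {n : ℕ} {I : Type} (e : Fin n ≃ I) (i : Fin n) :
    consEquiv e i.succ = some (e i) := rfl

@[simp] theorem consEquiv_symm_none {n : ℕ} {I : Type} (e : Fin n ≃ I) :
    (consEquiv e).symm none = 0 := rfl

@[simp] theorem consEquiv_symm_some {n : ℕ} {I : Type} (e : Fin n ≃ I) (i : I) :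
    (consEquiv e).symm (some i) = (e.symm i).succ := rfl

/-- Regrouping a sum whose first summand has a distinguished point. -/
def optionSum (I J : Type) : Option I ⊕ J ≃ Option (I ⊕ J) where
  toFun := Sum.elim (fun o => o.map Sum.inl) (fun i => some (Sum.inr i))
  invFun := fun o => o.elim (Sum.inl none) (Sum.map some id)
  left_inv := by rintro ((_ | _) | _) <;> rfl
  right_inv := by rintro (_ | _ | _) <;> rfl

variable [Monoid S] {F : Set (SOp S A)}

theorem IsSPreclone.perm_mem (hF : IsSPreclone F) {n : ℕ} (p : Equiv.Perm (Fin (n + 1))) (σ : Fin (n + 1) → S)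
    (φ : (Fin (n + 1) → A) → A) (h : (⟨n, σ, φ⟩ : SOp S A) ∈ F) :
    (⟨n, fun i => σ (p i), fun x => φ fun i => x (p.symm i)⟩ : SOp S A) ∈ F := by
  -- The permutations under which `F` is closed form a submonoid. It contains the generators coming
  -- from `ζ` and `τ`, and in a finite group the submonoid they generate is already the subgroup.
  let M : Submonoid (Equiv.Perm (Fin (n + 1))) :=
    { carrier := {p | ∀ (σ : Fin (n + 1) → S) (φ : (Fin (n + 1) → A) → A),
        (⟨n, σ, φ⟩ : SOp S A) ∈ F →
        (⟨n, fun i => σ (p⁻¹ i), fun x => φ fun i => x (p i)⟩ : SOp S A) ∈ F}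
      one_mem' := fun σ φ h => h
      mul_mem' := by
        intro p q hp hq σ φ h
        simpa [mul_inv_rev] using hp _ _ (hq _ _ h) }
  have key : ∀ q, q ∈ M := by
    intro q
    obtain _ | n := n
    · rw [show q = 1 from Equiv.ext fun i => Subsingleton.elim (α := Fin 1) _ _]
      exact M.one_mem
    · have hz : finRotate (n + 2) ∈ M := by
        intro σ φ h
        convert hF.zeta_mem _ h using 1
        refine SOp.mk_congr (fun i => ?_) (fun x => ?_)
        · congr 1
          rw [Equiv.Perm.inv_eq_iff_eq, finRotate_apply]
          simp
        · simp only [finRotate_apply]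
      have ht : Equiv.swap (0 : Fin (n + 2)) 1 ∈ M := by
        intro σ φ h
        convert hF.tau_mem _ h using 1
        exact SOp.mk_congr (fun i => by simp) (fun x => rfl)
      have hcl := Equiv.Perm.closure_cycle_adjacent_swap (isCycle_finRotate (n := n))
        support_finRotate 0
      have h1 : finRotate (n + 2) 0 = 1 := by simp
      rw [h1] at hcl
      have hle : Submonoid.closure {finRotate (n + 2), Equiv.swap 0 1} ≤ M := by
        rw [Submonoid.closure_le]
        rintro _ (rfl | rfl)
        exacts [hz, ht]
      apply hle
      rw [← Subgroup.closure_toSubmonoid_of_finite, hcl]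
      trivial
  have := key p⁻¹ σ φ h
  simpa using this

theorem IsSPreclone.mem_of_opMem (hF : IsSPreclone F) {I : Type} {σ : I → S} {φ : (I → A) → A} (h : OpMem F σ φ)
    {n : ℕ} (e : Fin (n + 1) ≃ I) :
    (⟨n, fun i => σ (e i), fun x => φ fun i => x (e.symm i)⟩ : SOp S A) ∈ F := by
  obtain ⟨m, e', h⟩ := h
  obtain rfl : m = n := by simpa using Fintype.card_congr (e'.trans e.symm)
  simpa using hF.perm_mem (e.trans e'.symm) _ _ h

theorem IsSPreclone.mem_iff_opMem (hF : IsSPreclone F) (f : SOp S A) : f ∈ F ↔ OpMem F f.sgn f.fn :=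
  ⟨OpMem.of_mem, fun h => hF.mem_of_opMem h (Equiv.refl _)⟩

theorem IsSPreclone.opMem_some (hF : IsSPreclone F) {I : Type} {σ : Option I → S} {φ : (I → A) → A}
    (h : OpMem F (fun i => σ (some i)) φ) : OpMem F σ (fun z => φ fun i => z (some i)) := by
  obtain ⟨n, e, h⟩ := h
  refine ⟨n + 1, consEquiv e, ?_⟩
  convert hF.nabla_mem (σ none) _ h using 1
  refine SOp.mk_congr (fun i => ?_) (fun x => ?_)
  · refine Fin.cases ?_ (fun i => ?_) i <;> simp
  · exact congrArg φ (funext fun i => by simp [Fin.tail])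

theorem IsSPreclone.opMem_merge (hF : IsSPreclone F) {J : Type} {σ : Option J → S} {φ : (Option J → A) → A}
    (h : OpMem F σ φ) (j : J) (hj : σ none = σ (some j)) :
    OpMem F (fun i => σ (some i)) (fun z => φ fun o => o.elim (z j) z) := by
  have : Finite (Option J) := h.finite
  have : Finite J := Finite.of_injective some (Option.some_injective J)
  have : Nonempty J := ⟨j⟩
  classical
  obtain ⟨k, hk⟩ : ∃ k, Nat.card J = k + 1 := Nat.exists_eq_succ_of_ne_zero Nat.card_pos.ne'
  obtain ⟨e₀⟩ : Nonempty (Fin (k + 1) ≃ J) := ⟨(Finite.equivFinOfCardEq hk).symm⟩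
  obtain ⟨e, he⟩ : ∃ e : Fin (k + 1) ≃ J, e 0 = j :=
    ⟨e₀.trans (Equiv.swap (e₀ 0) j), by simp⟩
  have h' := hF.delta_mem _
    (hF.mem_of_opMem h (consEquiv e))
  refine ⟨k, e, ?_⟩
  have h1 : consEquiv e 1 = some (e 0) := rfl
  rw [SOp.delta, if_pos (by simp [h1, he, hj])] at h'
  convert h' using 1
  refine SOp.mk_congr (fun i => by simp [Fin.tail]) (fun x => ?_)
  refine congrArg φ (funext fun o => ?_)
  cases o with
  | none => simp [← he]
  | some o => simp

theorem IsSPreclone.opMem_comp (hF : IsSPreclone F) {I J : Type} {σ : Option I → S} {φ : (Option I → A) → A}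
    {τ : J → S} {ψ : (J → A) → A} (hφ : OpMem F σ φ) (hψ : OpMem F τ ψ) :
    OpMem F (Sum.elim (fun j => τ j * σ none) fun i => σ (some i))
      (fun z => φ fun o => o.elim (ψ fun j => z (Sum.inl j)) fun i => z (Sum.inr i)) := by
  have : Finite (Option I) := hφ.finite
  have : Finite I := Finite.of_injective some (Option.some_injective I)
  have e : Fin (Nat.card I) ≃ I := (Finite.equivFin I).symm
  generalize Nat.card I = n at e
  obtain ⟨m, e', hψ⟩ := hψ
  have h := hF.comp_mem _
    (hF.mem_of_opMem hφ (consEquiv e)) _ hψ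
  refine ⟨m + n, ((finCongr (by omega)).trans finSumFinEquiv.symm).trans
    (Equiv.sumCongr e' e), ?_⟩
  convert h using 1
  refine SOp.mk_congr (fun i => ?_) (fun x => ?_)
  · obtain ⟨i, rfl⟩ := (finCongr (show m + 1 + n = m + n + 1 by omega)).surjective i
    obtain ⟨i, rfl⟩ := finSumFinEquiv.surjective i
    rcases i with i | i <;> simp [Fin.tail]
  · refine congrArg φ (funext fun o => ?_)
    cases o with
    | none => simp
    | some o => simp

theorem IsSPreclone.opMem_inr (hF : IsSPreclone F) {I : Type} (J : Type) [Finite J] :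
    ∀ {σ : J ⊕ I → S} {φ : (I → A) → A}, OpMem F (fun i => σ (Sum.inr i)) φ →
      OpMem F σ (fun z => φ fun i => z (Sum.inr i)) := by
  induction J using Finite.induction_empty_option with
  | of_equiv p ih =>
    intro σ φ h
    refine ((ih (σ := fun x => σ (Sum.map p id x)) h).equiv
      (Equiv.sumCongr p (Equiv.refl I))).congr ?_ fun z => rfl
    rintro (x | x) <;> simp
  | h_empty =>
    intro σ φ h
    refine (h.equiv (Equiv.emptySum PEmpty I).symm).congr ?_ fun z => rfl
    rintro (x | x)
    · exact x.elim
    · rfl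
  | h_option ih =>
    intro σ φ h
    refine ((hF.opMem_some (σ := fun x => σ ((optionSum _ _).symm x))
      (ih (σ := fun x => σ ((optionSum _ _).symm (some x))) h)).equiv
        (optionSum _ _).symm).congr ?_ fun z => rfl
    simp

theorem IsSPreclone.opMem_retract (hF : IsSPreclone F) {J : Type} (I : Type) [Finite I] :
    ∀ {σ : I ⊕ J → S} {φ : (I ⊕ J → A) → A} (π : I → J),
      (∀ i, σ (Sum.inr (π i)) = σ (Sum.inl i)) → OpMem F σ φ →
      OpMem F (fun j => σ (Sum.inr j)) (fun z => φ (Sum.elim (fun i => z (π i)) z)) := by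
  induction I using Finite.induction_empty_option with
  | of_equiv p ih =>
    intro σ φ π hπ h
    refine (ih (fun i => π (p i)) (σ := fun x => σ (Sum.map p id x)) (fun i => hπ (p i))
      ((h.equiv (Equiv.sumCongr p.symm (Equiv.refl J))).congr ?_ fun z => rfl)).congr
        (fun i => rfl) fun z => congrArg φ (funext ?_)
    · rintro (x | x) <;> rfl
    · rintro (x | x) <;> simp
  | h_empty =>
    intro σ φ π hπ h
    refine (h.equiv (Equiv.emptySum PEmpty J)).congr (fun i => rfl) fun z =>
      congrArg φ (funext ?_)
    rintro (x | x)
    · exact x.elim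
    · rfl
  | h_option ih =>
    intro σ φ π hπ h
    refine (ih (fun i => π (some i)) (fun i => hπ (some i))
      (hF.opMem_merge (h.equiv (optionSum _ _)) (Sum.inr (π none)) (hπ none).symm)).congr
        (fun i => rfl) fun z => congrArg φ (funext ?_)
    rintro ((_ | x) | x) <;> rfl

/-- Preclones are closed under label-preserving substitutions of variables. -/
theorem IsSPreclone.opMem_minor (hF : IsSPreclone F) {I J : Type} [Finite J] {σ : I → S} {τ : J → S}
    {φ : (I → A) → A} (h : OpMem F σ φ) (π : I → J) (hπ : ∀ i, τ (π i) = σ i) :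
    OpMem F τ (fun z => φ fun i => z (π i)) := by
  have : Finite I := h.finite
  -- Adjoining all of `J` as dummy variables first and then collapsing each `i` onto `π i` treats
  -- arbitrary `π` uniformly, injective or not.
  have h1 := hF.opMem_inr J (σ := Sum.elim τ σ) h
  have h2 := h1.equiv (Equiv.sumComm J I)
  exact hF.opMem_retract I π hπ h2

theorem labelledSpan_apply_mem {D : Type} {l : D → S} {σ : D → S} {s : S} {φ : (D → A) → A}
    (h : OpMem F σ φ) (hl : ∀ d, σ d * s = l d) : φ ∈ labelledSpan F l s :=
  ⟨D, σ, φ, id, h, hl, fun _ => rfl⟩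

/-- Composition fills one place at a time, so the induction is on the places `N` still to be filled,
while `I` collects the variables that stay. Each step moves a fresh copy of `D` into `I`; the copies
are merged afterwards. -/
theorem IsSPreclone.opMem_superposition_sum (hF : IsSPreclone F) {D : Type} [Finite D]
    {l : D → S} (N : Type) [Finite N] :
    ∀ {I : Type} [Finite I] {σ : N ⊕ I → S} {φ : (N ⊕ I → A) → A} {g : N → (D → A) → A},
      OpMem F σ φ → (∀ n, g n ∈ labelledSpan F l (σ (Sum.inl n))) →
      OpMem F (Sum.elim l fun i => σ (Sum.inr i))
        (fun z => φ (Sum.elim (fun n => g n fun d => z (Sum.inl d)) fun i => z (Sum.inr i))) := by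
  induction N using Finite.induction_empty_option with
  | of_equiv p ih =>
    intro I _ σ φ g h hg
    refine (ih (σ := fun x => σ (Sum.map p id x)) (g := fun n => g (p n))
      ((h.equiv (Equiv.sumCongr p.symm (Equiv.refl I))).congr ?_ fun z => rfl)
      (fun n => hg (p n))).congr (fun i => rfl) fun z => congrArg φ (funext ?_)
    · rintro (x | x) <;> rfl
    · rintro (x | x) <;> simp
  | h_empty =>
    intro I _ σ φ g h hg
    refine (hF.opMem_minor h (τ := Sum.elim l fun i => σ (Sum.inr i))
      (Sum.elim (fun x => x.elim) Sum.inr) ?_).congr (fun i => rfl) fun z =>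
        congrArg φ (funext ?_)
    all_goals
      rintro (x | x)
      · exact x.elim
      · rfl
  | h_option ih =>
    intro I _ σ φ g h hg
    obtain ⟨J, θ, ψ, π, hψ, hθ, hgψ⟩ := hg none
    have h1 := hF.opMem_comp (h.equiv (optionSum _ _)) hψ
    have h2 := hF.opMem_minor h1
      (τ := Sum.elim (fun n => σ (Sum.inl (some n))) (Sum.elim l fun i => σ (Sum.inr i)))
      (Sum.elim (fun j => Sum.inr (Sum.inl (π j))) (Sum.map id Sum.inr)) (by
        rintro (x | x | x)
        · exact (hθ x).symm
        · rfl
        · rfl)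
    refine (hF.opMem_minor (ih h2 fun n => hg (some n)) (Sum.elim Sum.inl id) ?_).congr
      (fun i => rfl) fun z => congrArg φ (funext ?_)
    · rintro (x | x | x) <;> rfl
    · rintro ((_ | x) | x)
      · exact hgψ _
      · rfl
      · rfl

theorem IsSPreclone.opMem_superposition (hF : IsSPreclone F) {D N : Type} [Finite D]
    {l : D → S} {σ : N → S} {φ : (N → A) → A} {g : N → (D → A) → A} (h : OpMem F σ φ)
    (hg : ∀ n, g n ∈ labelledSpan F l (σ n)) : OpMem F l (fun z => φ fun n => g n z) := by
  have : Finite N := h.finite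
  refine ((hF.opMem_superposition_sum N (I := Empty) (σ := Sum.elim σ Empty.elim) (g := g)
    ((h.equiv (Equiv.sumEmpty N Empty).symm).congr ?_ fun z => rfl) hg).equiv
      (Equiv.sumEmpty D Empty)).congr (fun i => rfl) fun z => rfl
  rintro (x | x)
  · rfl
  · exact x.elim

/-- The spans of an arbitrary labelled family of variables form an invariant `S`-relation. -/
theorem IsSPreclone.labelledSpan_invariant (hF : IsSPreclone F) {D N : Type} {l : D → S}
    {σ : N → S} {φ : (N → A) → A} {s : S} {g : N → (D → A) → A} (h : OpMem F σ φ)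
    (hg : ∀ n, g n ∈ labelledSpan F l (σ n * s)) :
    (fun z => φ fun n => g n z) ∈ labelledSpan F l s := by
  have : Finite N := h.finite
  choose J θ ψ π hψ hθ hg using hg
  have : ∀ n, Finite (J n) := fun n => (hψ n).finite
  -- The variables of the different `ψ n` are kept apart: their labels `θ * σ n` need to match `l`
  -- only after multiplication by `s`, so variables sent to the same `d` may carry different labels.
  refine ⟨Σ n, J n, fun p => θ p.1 p.2 * σ p.1, fun z => φ fun n => ψ n fun j => z ⟨n, j⟩,
    fun p => π p.1 p.2, hF.opMem_superposition h fun n => ?_, ?_, fun z => ?_⟩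
  · exact ⟨J n, θ n, ψ n, fun j => ⟨n, j⟩, hψ n, fun j => rfl, fun z => rfl⟩
  · rintro ⟨n, j⟩
    exact (mul_assoc _ _ _).trans (hθ n j)
  · simp only [hg]

theorem IsSPreclone.var_mem_labelledSpan (hF : IsSPreclone F) {D : Type} (l : D → S) (d : D) :
    (fun z : D → A => z d) ∈ labelledSpan F l (l d) :=
  ⟨Fin 1, fun _ => 1, fun z => z 0, fun _ => d, OpMem.of_mem hF.ident_mem, fun _ => one_mul _,
    fun _ => rfl⟩

/-- At `s = 1` the labels are forced to be those of `l`, so the substitution is an ordinary minor.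
-/
theorem IsSPreclone.mem_labelledSpan_one (hF : IsSPreclone F) {D : Type} [Finite D] {l : D → S}
    {g : (D → A) → A} : g ∈ labelledSpan F l 1 ↔ OpMem F l g := by
  constructor
  · rintro ⟨J, θ, ψ, π, hψ, hθ, hg⟩
    exact (hF.opMem_minor hψ π fun j => by rw [← hθ, mul_one]).congr (fun _ => rfl) hg
  · exact fun h => labelledSpan_apply_mem h fun d => mul_one _

theorem IsSPreclone.trivial_mem (hF : IsSPreclone F) {f : SOp S A} (hf : f.IsTrivial) :
    f ∈ F := by
  obtain ⟨i, hi, h⟩ := hf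
  rw [hF.mem_iff_opMem, ← hF.mem_labelledSpan_one, ← hi]
  convert hF.var_mem_labelledSpan f.sgn i using 1
  exact funext h

end Preclone

/-! ### Maximal preclones and invariant relations -/

section Maximal

variable {S A : Type*} [Monoid S] {F : Set (SOp S A)}

theorem isSPreclone_SPol {m : ℕ} (ρ : SRel S A m) : IsSPreclone (SPol ρ) where
  ident_mem := fun s r h => by
    have := h 0
    rwa [show (SOp.ident : SOp S A).sgn 0 = 1 from rfl, one_mul] at this
  zeta_mem := fun f hf s r h => hf s (fun i : Fin (f.pred + 1) => r (i + 1 : Fin (f.pred + 1)))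
    fun i => by simpa [SOp.zeta] using h (i + 1 : Fin (f.pred + 1))
  tau_mem := fun f hf s r h => hf s
    (fun i : Fin (f.pred + 1) => r (Equiv.swap (0 : Fin (f.pred + 1)) 1 i)) fun i => by
      have := h (Equiv.swap (0 : Fin (f.pred + 1)) 1 i)
      simp only [SOp.tau, Equiv.swap_apply_self] at this
      exact this
  nabla_mem := fun t f hf s r h => hf s (fun i => r i.succ) fun i => by
    simpa [SOp.nabla] using h i.succ
  delta_mem := by
    rintro ⟨_ | k, σ, φ⟩ hf
    · exact hf
    · rw [SOp.delta]
      split_ifs with hσ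
      · intro s r h
        have := hf s (Fin.cons (r 0) r) fun i => by
          refine Fin.cases ?_ (fun i => ?_) i
          · simpa [Fin.tail, hσ] using h 0
          · simpa [Fin.tail] using h i
        convert this using 1
        funext j
        refine congrArg φ (funext fun i => ?_)
        refine Fin.cases ?_ (fun i => ?_) i <;> simp
      · exact hf
  comp_mem := by
    rintro ⟨n, σ, φ⟩ hf ⟨m, τ, ψ⟩ hg s r h
    have hc : m + 1 + n = m + n + 1 := by omega
    have hr : ∀ i : Fin (m + 1 + n), r (Fin.cast hc i) ∈
        ρ (Fin.append (fun j => τ j * σ 0) (Fin.tail σ) i * s) :=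
      fun i => h (Fin.cast hc i)
    -- The inner operation is used at the index `σ 0 * s`; associativity matches this with the
    -- product labels of the composite.
    have h1 := hg (σ 0 * s) (fun j => r (Fin.cast hc (Fin.castAdd n j)))
      fun j => by simpa [mul_assoc] using hr (Fin.castAdd n j)
    have h2 := hf s (Fin.cons _ fun j =>
      r (Fin.cast hc (Fin.natAdd (m + 1) j))) fun i => by
        refine Fin.cases ?_ (fun i => ?_) i
        · exact h1
        · simpa [Fin.tail] using hr (Fin.natAdd (m + 1) i)
    convert h2 using 1
    funext j
    refine congrArg φ (funext fun i => ?_)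
    refine Fin.cases ?_ (fun i => ?_) i <;> rfl

theorem IsMaximalSPreclone.eq_SPol [Finite A] (hF : IsMaximalSPreclone F) {f : SOp S A}
    (hf : f ∉ F) : ∃ ρ : SRel S A (Nat.card A ^ f.arity), F = SPol ρ := by
  have hP := hF.prop.1
  have hcard : Nat.card (Fin (f.pred + 1) → A) = Nat.card A ^ f.arity := by
    simp [SOp.arity, Nat.card_fun]
  let e : (Fin (f.pred + 1) → A) ≃ Fin (Nat.card A ^ f.arity) := Finite.equivFinOfCardEq hcard
  let ρ : SRel S A (Nat.card A ^ f.arity) := fun s => {r | (fun z => r (e z)) ∈ labelledSpan F f.sgn s}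
  have hle : F ⊆ SPol ρ := fun g hg s r hr => hP.labelledSpan_invariant (OpMem.of_mem hg) hr
  have hne : f ∉ SPol ρ := fun h => hf <| by
    have := h 1 (fun i j => e.symm j i) fun i => by
      simpa [ρ] using hP.var_mem_labelledSpan f.sgn i
    rw [hP.mem_iff_opMem, ← hP.mem_labelledSpan_one]
    simpa [ρ] using this
  refine ⟨ρ, hle.antisymm (hF.le_of_ge ⟨isSPreclone_SPol ρ, fun h => hne (h ▸ trivial)⟩ hle)⟩

/-- On a finite set, all functions can be composed from binary ones. -/
theorem eq_univ_of_binary_closed [Finite A] {X : Type*} [Finite X] [Nonempty X]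
    {C : Set ((X → A) → A)} (hvar : ∀ i, (fun z : X → A => z i) ∈ C)
    (hbin : ∀ b : A → A → A, ∀ u ∈ C, ∀ v ∈ C, (fun z => b (u z) (v z)) ∈ C) : C = Set.univ := by
  classical
  have := Fintype.ofFinite A
  have := Fintype.ofFinite X
  obtain ⟨i₀⟩ := ‹Nonempty X›
  rw [Set.eq_univ_iff_forall]
  intro f
  obtain h | h := subsingleton_or_nontrivial A
  · convert hvar i₀
  obtain ⟨a₀, a₁, hne⟩ := exists_pair_ne A
  -- With `a₁` as true and `a₀` as false, these are indicators of the points agreeing with `a` on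
  -- `J`; for `J` everything, of `a` alone.
  have hpoint : ∀ (a : X → A) (J : Finset X),
      (fun z : X → A => if ∀ i ∈ J, z i = a i then a₁ else a₀) ∈ C := by
    intro a J
    induction J using Finset.induction_on with
    | empty => simpa using hbin (fun _ _ => a₁) _ (hvar i₀) _ (hvar i₀)
    | insert i J hi ih =>
      convert hbin (fun u v => if u = a i ∧ v = a₁ then a₁ else a₀) _ (hvar i) _ ih using 2 with z
      by_cases h : ∀ i ∈ J, z i = a i <;> simp [h, hne]
  -- The values of `f` are entered one point at a time over the constant `a₀`.
  have hsum : ∀ T : Finset (X → A), (fun z => if z ∈ T then f z else a₀) ∈ C := by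
    intro T
    induction T using Finset.induction_on with
    | empty => simpa using hbin (fun _ _ => a₀) _ (hvar i₀) _ (hvar i₀)
    | insert a T ha ih =>
      convert hbin (fun u v => if u = a₁ then f a else v) _ (hpoint a Finset.univ) _ ih
        using 2 with z
      by_cases h : z = a
      · simp [h]
      · have h' : ¬ ∀ i, z i = a i := fun h' => h (funext h')
        simp [h, h', hne]
  simpa using hsum Finset.univ

/-- Binary operations give every function with all labels `e`; substituting the identity with signum
`s_i` for the `i`-th variable then produces any signum. -/
theorem IsSPreclone.eq_univ [Finite A] (hF : IsSPreclone F)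
    (h₁ : ∀ s, (⟨0, fun _ => s, fun x => x 0⟩ : SOp S A) ∈ F)
    (h₂ : ∀ b : A → A → A, (⟨1, fun _ => 1, fun x => b (x 0) (x 1)⟩ : SOp S A) ∈ F) :
    F = Set.univ := by
  rw [Set.eq_univ_iff_forall]
  rintro ⟨n, σ, φ⟩
  have hC : {ψ : (Fin (n + 1) → A) → A | OpMem F (fun _ => 1) ψ} = Set.univ := by
    refine eq_univ_of_binary_closed (fun i => ?_) fun b u hu v hv => ?_
    · exact hF.mem_labelledSpan_one.1 (hF.var_mem_labelledSpan (fun _ => 1) i)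
    · refine (hF.opMem_superposition (l := fun _ => 1) (OpMem.of_mem (h₂ b)) (g := ![u, v])
        fun i => ?_).congr (fun _ => rfl) fun _ => rfl
      fin_cases i
      exacts [hF.mem_labelledSpan_one.2 hu, hF.mem_labelledSpan_one.2 hv]
  have hφ : OpMem F (fun _ => 1) φ := (Set.ext_iff.1 hC φ).2 trivial
  rw [hF.mem_iff_opMem]
  refine hF.opMem_superposition hφ (g := fun i z => z i) fun i => ?_
  exact ⟨Fin 1, fun _ => σ i, fun z => z 0, fun _ => i, OpMem.of_mem (h₁ (σ i)),
    fun _ => mul_one _, fun _ => rfl⟩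

theorem IsMaximalSPreclone.exists_eq_SPol [Finite A] (hF : IsMaximalSPreclone F) :
    ∃ m : ℕ, (m = Nat.card A ^ 2 ∨ m = Nat.card A) ∧ ∃ ρ : SRel S A m, F = SPol ρ := by
  by_cases h₁ : ∀ s, (⟨0, fun _ => s, fun x => x 0⟩ : SOp S A) ∈ F
  · by_cases h₂ : ∀ b : A → A → A, (⟨1, fun _ => 1, fun x => b (x 0) (x 1)⟩ : SOp S A) ∈ F
    · exact absurd (hF.prop.1.eq_univ h₁ h₂) hF.prop.2
    · obtain ⟨b, hb⟩ := not_forall.1 h₂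
      exact ⟨_, Or.inl rfl, hF.eq_SPol hb⟩
  · obtain ⟨s, hs⟩ := not_forall.1 h₁
    exact ⟨_, Or.inr (pow_one _), hF.eq_SPol hs⟩

theorem finite_setOf_isMaximalSPreclone (S A : Type*) [Monoid S] [Finite S] [Finite A] :
    {F : Set (SOp S A) | IsMaximalSPreclone F}.Finite := by
  refine ((Set.finite_range fun ρ : SRel S A (Nat.card A ^ 2) => SPol ρ).union
    (Set.finite_range fun ρ : SRel S A (Nat.card A) => SPol ρ)).subset fun F hF => ?_
  obtain ⟨m, rfl | rfl, ρ, rfl⟩ := IsMaximalSPreclone.exists_eq_SPol hF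
  exacts [Or.inl ⟨ρ, rfl⟩, Or.inr ⟨ρ, rfl⟩]

end Maximal

/-! ### Minimal preclones and small nontrivial minors -/

section Minimal

variable {S A : Type*} [Monoid S]

/-- A function on a finite power that agrees, on the substitution instances of any two points,
with some variable from `P`, is a variable from `P`. -/
theorem exists_eq_var_of_pairwise [Nonempty A] {X : Type*} [Finite X] {P : X → Prop}
    {f : (X → A) → A}
    (h : ∀ x y : X → A, ∃ k, P k ∧ ∀ g : A → A → A, f (fun i => g (x i) (y i)) = g (x k) (y k)) :
    ∃ k, P k ∧ ∀ x, f x = x k := by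
  classical
  have := Fintype.ofFinite X
  obtain hA | hA := subsingleton_or_nontrivial A
  · obtain ⟨a⟩ := ‹Nonempty A›
    obtain ⟨k, hk, -⟩ := h (fun _ => a) fun _ => a
    exact ⟨k, hk, fun x => Subsingleton.elim _ _⟩
  obtain ⟨a₀, a₁, hne⟩ := exists_pair_ne A
  let χ : Finset X → X → A := fun U i => if i ∈ U then a₁ else a₀
  have hχ : ∀ {U i}, χ U i = a₁ ↔ i ∈ U := by
    intro U i
    by_cases hi : i ∈ U <;> simp [χ, hi, hne]
  -- The sets `U` with `f (χ U) = a₁` form a filter; on a finite set it has a least member, which is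
  -- shown to be a singleton.
  have htop : f (χ ⊤) = a₁ := by
    obtain ⟨k, -, hg⟩ := h (fun _ => a₁) fun _ => a₁
    simpa [χ] using hg fun u _ => u
  have hinter : ∀ U V, f (χ U) = a₁ → f (χ V) = a₁ → f (χ (U ⊓ V)) = a₁ := by
    intro U V hU hV
    obtain ⟨k, -, hg⟩ := h (χ U) (χ V)
    have h1 := (hg fun u _ => u).symm.trans hU
    have h2 := (hg fun _ v => v).symm.trans hV
    have h3 := hg fun u v => if u = a₁ ∧ v = a₁ then a₁ else a₀
    rw [if_pos ⟨h1, h2⟩] at h3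
    rw [← h3]
    refine congrArg f (funext fun i => ?_)
    simp [hχ, χ]
  have hK : f (χ ((Finset.univ.filter fun U => f (χ U) = a₁).inf id)) = a₁ :=
    Finset.inf_induction (p := fun U => f (χ U) = a₁) htop (fun U hU V hV => hinter U V hU hV) fun U hU => (Finset.mem_filter.1 hU).2
  -- Only the first point matters here, `χ ∅` being a filler: `k` lies in the least member, hence in
  -- all members.
  obtain ⟨k, hk, hg⟩ := h (χ ((Finset.univ.filter fun U => f (χ U) = a₁).inf id)) (χ ∅)
  have hkK := hχ.1 ((hg fun u _ => u).symm.trans hK)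
  have hmem : ∀ U, f (χ U) = a₁ → k ∈ U := fun U hU =>
    Finset.inf_le (f := id) (Finset.mem_filter.2 ⟨Finset.mem_univ U, hU⟩) hkK
  have hsing : f (χ {k}) = a₁ := by
    obtain ⟨j, -, hj⟩ := h (χ {k}) (χ {k})
    by_cases hjk : j = k
    · exact (hj fun u _ => u).trans (hχ.2 (by simp [hjk]))
    -- If `j ≠ k`, exchanging `a₀` and `a₁` puts the complement of `{k}` in the filter, although `k`
    -- lies in every member.
    · have h1 := hj fun u _ => if u = a₁ then a₀ else a₁
      rw [if_neg (by simp [hχ, hjk])] at h1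
      have h2 : f (χ {k}ᶜ) = a₁ := by
        rw [← h1]
        refine congrArg f (funext fun i => ?_)
        by_cases hi : i = k <;> simp [χ, hi, hne]
      simpa using hmem _ h2
  refine ⟨k, hk, fun x => ?_⟩
  -- Pairing `x` with `χ {k}` forces the variable chosen for `x` to be `k`.
  obtain ⟨j, -, hj⟩ := h x (χ {k})
  have hjk : j = k := by simpa [hχ] using (hj fun _ v => v).symm.trans hsing
  rw [← hjk]
  exact hj fun u _ => u

/-- A nontrivial `S`-operation has a nontrivial minor of bounded arity. -/
theorem IsSPreclone.exists_nontrivial_arity_le [Finite S] [Finite A] [Nonempty A]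
    {F : Set (SOp S A)} (hF : IsSPreclone F) {f : SOp S A} (hf : f ∈ F) (hnt : ¬ f.IsTrivial) :
    ∃ h ∈ F, ¬ h.IsTrivial ∧ h.arity ≤ Nat.card A ^ 2 * Nat.card S := by
  -- A single pair `x`, `y` defeats every candidate `k`; only `g` depends on `k`.
  obtain ⟨x, y, hxy⟩ : ∃ x y : Fin (f.pred + 1) → A, ∀ k, f.sgn k = 1 →
      ∃ g : A → A → A, f.fn (fun i => g (x i) (y i)) ≠ g (x k) (y k) := by
    by_contra! hcon
    exact hnt (exists_eq_var_of_pairwise hcon)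
  -- Equal labels make the identification legal; equal values of `x` and `y` let both points descend
  -- to the minor.
  let q : Fin (f.pred + 1) → S × A × A := fun i => (f.sgn i, x i, y i)
  have hle : Nat.card (Set.range q) ≤ Nat.card A ^ 2 * Nat.card S := by
    calc Nat.card (Set.range q) ≤ Nat.card (S × A × A) :=
          Nat.card_le_card_of_injective _ Subtype.val_injective
      _ = Nat.card A ^ 2 * Nat.card S := by simp only [Nat.card_prod]; ring
  have : Nonempty (Set.range q) := ⟨⟨q 0, 0, rfl⟩⟩
  obtain ⟨m, hm⟩ : ∃ m, Nat.card (Set.range q) = m + 1 :=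
    Nat.exists_eq_succ_of_ne_zero Nat.card_pos.ne'
  let e : Set.range q ≃ Fin (m + 1) := Finite.equivFinOfCardEq hm
  let π : Fin (f.pred + 1) → Fin (m + 1) := fun i => e ⟨q i, i, rfl⟩
  have hπ : ∀ i, (e.symm (π i)).1 = q i := fun i => by simp [π]
  refine ⟨⟨m, fun j => (e.symm j).1.1, fun z => f.fn fun i => z (π i)⟩, ?_, ?_, hm.symm.trans_le hle⟩
  · rw [hF.mem_iff_opMem]
    exact hF.opMem_minor (OpMem.of_mem hf) π fun i => congrArg Prod.fst (hπ i)
  · rintro ⟨j, hj, hproj⟩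
    obtain ⟨⟨_, k, rfl⟩, rfl⟩ := e.surjective j
    change (e.symm (π k)).1.1 = 1 at hj
    rw [hπ] at hj
    obtain ⟨g, hg⟩ := hxy k hj
    apply hg
    have := hproj fun j => g (e.symm j).1.2.1 (e.symm j).1.2.2
    change f.fn (fun i => g (e.symm (π i)).1.2.1 (e.symm (π i)).1.2.2) =
      g (e.symm (π k)).1.2.1 (e.symm (π k)).1.2.2 at this
    simpa only [hπ] using this

theorem isSPreclone_SSg (F : Set (SOp S A)) : IsSPreclone (SSg F) where
  ident_mem := fun _ hG => hG.1.ident_mem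
  zeta_mem := fun f hf G hG => hG.1.zeta_mem f (hf G hG)
  tau_mem := fun f hf G hG => hG.1.tau_mem f (hf G hG)
  nabla_mem := fun s f hf G hG => hG.1.nabla_mem s f (hf G hG)
  delta_mem := fun f hf G hG => hG.1.delta_mem f (hf G hG)
  comp_mem := fun f hf g hg G hG => hG.1.comp_mem f (hf G hG) g (hg G hG)

theorem IsMinimalSPreclone.exists_eq_SSg [Finite S] [Finite A] [Nonempty A]
    {F : Set (SOp S A)} (hF : IsMinimalSPreclone F) :
    ∃ f : SOp S A, ¬ f.IsTrivial ∧ f.arity ≤ Nat.card A ^ 2 * Nat.card S ∧ F = SSg {f} := by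
  have hP := hF.prop.1
  obtain ⟨f, hf, hnt⟩ : ∃ f ∈ F, ¬ f.IsTrivial := by
    by_contra! hcon
    exact hF.prop.2 (Set.Subset.antisymm hcon fun f hf => hP.trivial_mem hf)
  obtain ⟨h, hh, hnt, har⟩ := hP.exists_nontrivial_arity_le hf hnt
  have hle : SSg {h} ⊆ F := Set.sInter_subset_of_mem ⟨hP, Set.singleton_subset_iff.2 hh⟩
  have hmem : h ∈ SSg {h} := fun G hG => hG.2 rfl
  have hne : SSg {h} ≠ trivialSOps S A := fun heq => hnt (by rw [heq] at hmem; exact hmem)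
  exact ⟨h, hnt, har, (hF.le_of_le ⟨isSPreclone_SSg _, hne⟩ hle).antisymm hle⟩

theorem finite_setOf_arity_le (S A : Type*) [Finite S] [Finite A] (N : ℕ) :
    {f : SOp S A | f.arity ≤ N}.Finite := by
  refine (Set.finite_range fun p : Σ n : Fin N,
    (Fin (n.1 + 1) → S) × ((Fin (n.1 + 1) → A) → A) =>
      (⟨p.1, p.2.1, p.2.2⟩ : SOp S A)).subset ?_
  rintro ⟨n, σ, φ⟩ h
  exact ⟨⟨⟨n, h⟩, σ, φ⟩, rfl⟩

theorem finite_setOf_isMinimalSPreclone (S A : Type*) [Monoid S] [Finite S] [Finite A]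
    [Nonempty A] : {F : Set (SOp S A) | IsMinimalSPreclone F}.Finite := by
  refine ((finite_setOf_arity_le S A (Nat.card A ^ 2 * Nat.card S)).image
    fun f => SSg {f}).subset fun F hF => ?_
  obtain ⟨f, -, har, rfl⟩ := IsMinimalSPreclone.exists_eq_SSg hF
  exact ⟨f, har, rfl⟩

end Minimal

theorem proposition5p2 (S A : Type*) [Monoid S] [Finite S] [Finite A] [Nonempty A] :
    {F : Set (SOp S A) | IsMaximalSPreclone F}.Finite ∧
    {F : Set (SOp S A) | IsMinimalSPreclone F}.Finite ∧
    (∀ F : Set (SOp S A), IsMaximalSPreclone F →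
      ∃ m : ℕ, (m = Nat.card A ^ 2 ∨ m = Nat.card A) ∧ ∃ ρ : SRel S A m, F = SPol ρ) ∧
    (∀ F : Set (SOp S A), IsMinimalSPreclone F →
      ∃ f : SOp S A, ¬ f.IsTrivial ∧ f.arity ≤ Nat.card A ^ 2 * Nat.card S ∧ F = SSg {f}) :=
  ⟨finite_setOf_isMaximalSPreclone S A, finite_setOf_isMinimalSPreclone S A,
    fun _ hF => hF.exists_eq_SPol, fun _ hF => hF.exists_eq_SSg⟩
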